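/- **Model.** Let $d,n\ge 1$, let $\mathbb X\in\mathbf R^{d\times n}$ have columns $X_1,\dots,X_n$, let $\Omega$ be a set of pairs $(i,j)$ with $1\le i<j\le n$, and put $N=|\Omega|$. For a symmetric matrix $\Theta\in\mathbf S^d$ let $\mathbf P_\Theta$ be the law of independent variables $Y_{(i,j)}\sim\mathrm{Bernoulli}\big(\sigma(X_i^\top\Theta X_j)\big)$, $(i,j)\in\Omega$, where $\sigma(t)=1/(1+e^{-t})$. Let $\|A\|_F^2=\sum_{i,j}A_{ij}^2$ and $\|B\|_{F,\Omega}^2=\sum_{(i,j)\in\Omega}B_{ij}^2$, let $\|A\|_{1,1}=\sum_{i,j}|A_{ij}|$, and let $\|A\|_{0,0}$ be the number of non-zero rows of $A$. For $M>0$ let $$\mathcal P_{k,r}(M)=\{\Theta\in\mathbf S^d:\ \|\Theta\|_{1,1}<M,\ \|\Theta\|_{0,0}\le k,\ \operatorname{rank}\Theta\le r\}.$$ **Block isometry.** Let $\Delta_{\Omega,s}(\mathbb X)$ be the infimum of all $\delta>0$ such that $$N(1-\delta)\|B\|_F^2\le\|\mathbb X^\top B\,\mathbb X\|_{F,\Omega}^2\le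 N(1+\delta)\|B\|_F^2\qquad\text{for all }B\in\mathbf S^d\text{ with }\|B\|_{0,0}\le s .$$ The block isometry property at block size $s$ says that some $\delta\in(0,1)$ satisfies these inequalities. **Theorem (minimax lower bound).** For every $c>0$ there is a constant $C_2>0$, depending only on $c$, such that the following holds for all $d,n$, all $1\le k\le d$ and $1\le r\le k$, all $M>0$, $\Omega$ and $\mathbb X$. If $\mathbb X$ has the block isometry property at block size $2k$, and if the $\ell_1$-radius $M$ of the parameter space is not too small compared with the noise level, namely $$M^2N\ \ge\ c\,k^2\Big(r^2+\log\frac{de}{k}\Big),$$ then $$\inf_{\hat\Theta}\ \sup_{\Theta_\star\in\mathcal P_{k,r}(M)}\mathbf E_{\Theta_\star}\big[\|\hat\Theta-\Theta_\star\|_F^2\big]\ \ge\ \frac{C_2}{1+\Delta_{\Omega,2k}(\mathbb X)}\Big(\frac{kr}{N}+\frac kN\log\frac{de}{k}\Big),$$ where the infimum is over all estimators $\hat\Theta=\hat\Theta(Y)\in\mathbf R^{d\times d}$. -/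

import Mathlib

open MeasureTheory ProbabilityTheory
open scoped ENNReal

namespace MatrixLogistic

noncomputable section

/-- The couples of `[n]`: unordered pairs of distinct vertices, each represented by `(i, j)` with
`i < j`. -/
def couples (n : ℕ) : Finset (Fin n × Fin n) :=
  Finset.univ.filter fun e => e.1 < e.2

/-- The squared Frobenius norm `∑ i j, A i j ^ 2`. -/
def frobSq {d : ℕ} (A : Matrix (Fin d) (Fin d) ℝ) : ℝ :=
  ∑ i, ∑ j, A i j ^ 2

/-- The squared semi-norm `‖B‖_{F,Ω}²`, the sum of `B i j ^ 2` over `(i, j) ∈ Ω`. -/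
def frobSqOn {n : ℕ} (Ω : Finset (Fin n × Fin n)) (B : Matrix (Fin n) (Fin n) ℝ) : ℝ :=
  ∑ e ∈ Ω, B e.1 e.2 ^ 2

/-- The entrywise `ℓ¹` norm `‖A‖_{1,1}`. -/
def normOneOne {d : ℕ} (A : Matrix (Fin d) (Fin d) ℝ) : ℝ :=
  ∑ i, ∑ j, |A i j|

/-- `‖A‖_{0,0}`: the number of rows of `A` that are not identically zero.  For symmetric `A` it is
at most `k` iff `A` is supported on `S × S` for some set `S` of at most `k` indices. -/
def normZeroZero {d : ℕ} (A : Matrix (Fin d) (Fin d) ℝ) : ℕ :=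
  {i : Fin d | ∃ j, A i j ≠ 0}.ncard

/-- The parameter space `𝒫_{k,r}(M)`. -/
def paramSpace (d k r : ℕ) (M : ℝ) : Set (Matrix (Fin d) (Fin d) ℝ) :=
  {Θ | Θ.IsSymm ∧ normOneOne Θ < M ∧ normZeroZero Θ ≤ k ∧ Θ.rank ≤ r}

/-- The affinity matrix `𝕏ᵀ Θ 𝕏`, with entries `X_iᵀ Θ X_j` where `X_i` is the `i`-th column
of `𝕏`. -/
def affinity {d n : ℕ} (X : Matrix (Fin d) (Fin n) ℝ) (Θ : Matrix (Fin d) (Fin d) ℝ) :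
    Matrix (Fin n) (Fin n) ℝ :=
  X.transpose * Θ * X

/-- The two-sided block isometry inequality with constant `δ` at block size `s`, where
`N = |Ω|`. -/
def IsBlockIsometryConst {d n : ℕ} (Ω : Finset (Fin n × Fin n)) (s : ℕ)
    (X : Matrix (Fin d) (Fin n) ℝ) (δ : ℝ) : Prop :=
  ∀ B : Matrix (Fin d) (Fin d) ℝ, B.IsSymm → normZeroZero B ≤ s →
    (Ω.card : ℝ) * (1 - δ) * frobSq B ≤ frobSqOn Ω (affinity X B) ∧
    frobSqOn Ω (affinity X B) ≤ (Ω.card : ℝ) * (1 + δ) * frobSq B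

/-- The block isometry constant `Δ_{Ω,s}(𝕏)`: the infimum of the admissible positive reals. -/
def blockIsometryConst {d n : ℕ} (Ω : Finset (Fin n × Fin n)) (s : ℕ)
    (X : Matrix (Fin d) (Fin n) ℝ) : ℝ :=
  sInf {δ : ℝ | 0 < δ ∧ IsBlockIsometryConst Ω s X δ}

/-- The block isometry property at block size `s`: some constant in `(0, 1)` is admissible. -/
def BlockIsometryProperty {d n : ℕ} (Ω : Finset (Fin n × Fin n)) (s : ℕ)
    (X : Matrix (Fin d) (Fin n) ℝ) : Prop :=
  ∃ δ : ℝ, 0 < δ ∧ δ < 1 ∧ IsBlockIsometryConst Ω s X δ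

/-- The law `P_Θ` of the observations `(Y_(i,j))`, `(i, j) ∈ Ω`: independent Bernoulli variables
with success probabilities `σ(X_iᵀ Θ X_j)`, `σ` the sigmoid function (`true` stands for `1`). -/
def dataLaw {d n : ℕ} (Ω : Finset (Fin n × Fin n)) (X : Matrix (Fin d) (Fin n) ℝ)
    (Θ : Matrix (Fin d) (Fin d) ℝ) : Measure (Ω → Bool) :=
  Measure.pi fun e : Ω =>
    bernoulliMeasure true false (unitInterval.sigmoid (affinity X Θ e.1.1 e.1.2))

/-- The risk `E_Θ ‖Θ̂(Y) - Θ‖_F²` of the estimator `est`. -/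
def risk {d n : ℕ} (Ω : Finset (Fin n × Fin n)) (X : Matrix (Fin d) (Fin n) ℝ)
    (est : (Ω → Bool) → Matrix (Fin d) (Fin d) ℝ) (Θ : Matrix (Fin d) (Fin d) ℝ) : ℝ≥0∞ :=
  ∫⁻ y, ENNReal.ofReal (frobSq (est y - Θ)) ∂(dataLaw Ω X Θ)

/-- The minimax risk over `𝒫_{k,r}(M)`.  The infimum is over all functions of the observations;
the sample space is finite and discrete, so every such function is measurable. -/
def minimaxRisk {d n : ℕ} (Ω : Finset (Fin n × Fin n)) (X : Matrix (Fin d) (Fin n) ℝ)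
    (k r : ℕ) (M : ℝ) : ℝ≥0∞ :=
  ⨅ est : (Ω → Bool) → Matrix (Fin d) (Fin d) ℝ, ⨆ Θ ∈ paramSpace d k r M, risk Ω X est Θ

end

end MatrixLogistic

/-! Place a uniform prior on a family of parameters indexed by `ι → S`: independent blocks, each in
one of `q` states. If changing the state of one block moves the law of the data only slightly, no
estimator can identify that state, so every block contributes a fixed loss; when the blocks are read
from disjoint sets of entries, these losses add up inside `frobSq`. Some parameter has risk at least
the average (`ofReal_le_minimaxRisk`).

Closeness is measured in `χ²`. For Bernoulli laws with log-odds `x` and `z` the affinity is at most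
`exp ((x - z) ^ 2 / 4)`, and it multiplies over `Ω`. The isometry property therefore turns closeness
of laws into Frobenius closeness of parameters: squared distance of order `(log q) / N` is
indistinguishable.

Two families give the two terms. For `(k / N) log (de / k)`, take `a u uᵀ` where `u` has a hub
coordinate `1` and `k - 1` small coordinates, each placed in one of about `d / k` positions or
absent. The matrix has rank one, yet its hub row is linear in the states, so each block costs about
`log (de / k) / N`. With `k = 1` no small coordinate remains, and a single diagonal entry is hidden
instead. For `kr / N`, take independent `0`-`a` entries in an off-diagonal block with `r / 2` rows,
symmetrized to rank at most `r`; each bit costs about `1 / N`. The condition on `M` keeps both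
families inside the `ℓ¹` ball. -/

namespace MatrixLogistic

/-! ### Bayes risk under a product prior -/

/-- Summing over all configurations of blocks can be done by first resampling one block. -/
lemma card_mul_sum_eq_sum_sum_update {ι S : Type*} [Fintype ι] [DecidableEq ι] [Fintype S]
    (b : ι) (f : (ι → S) → ℝ) :
    (Fintype.card S : ℝ) * ∑ τ, f τ = ∑ τ, ∑ s, f (Function.update τ b s) := by
  classical
  -- Exchanging the state of block `b` with an independent copy is a bijection of `(ι → S) × S`.
  have hinv : Function.Involutive
      (fun p : (ι → S) × S => (Function.update p.1 b p.2, p.1 b)) := by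
    rintro ⟨τ, s⟩
    simp
  rw [← Fintype.sum_prod_type' (f := fun τ s => f (Function.update τ b s)),
    hinv.bijective.sum_comp (fun p : (ι → S) × S => f p.1), Fintype.sum_prod_type]
  simp [Finset.mul_sum]

/-- Multiple testing: if all hypotheses are close in `χ²`-divergence to a common one of them, then
the sum over the hypotheses of the expected losses is large. -/
lemma sum_expected_loss_ge {S Y : Type*} [Fintype S] [Fintype Y]
    (hq : 2 ≤ Fintype.card S) (w : S → Y → ℝ) (hw : ∀ s y, 0 < w s y) (hw1 : ∀ s, ∑ y, w s y = 1)
    (s₀ : S) (hH : ∀ s, ∑ y, w s y ^ 2 / w s₀ y ≤ √(Fintype.card S))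
    (L : S → Y → ℝ) (hL : ∀ s y, 0 ≤ L s y) (η : ℝ) (hη : 0 ≤ η)
    (hsep : ∀ s t y, s ≠ t → η ≤ L s y + L t y) :
    (Fintype.card S : ℝ) * (η / 16) ≤ ∑ s, ∑ y, w s y * L s y := by
  classical
  set q : ℝ := (Fintype.card S : ℝ) with hqdef
  have hq2 : (2 : ℝ) ≤ q := by rw [hqdef]; exact_mod_cast hq
  -- With `p = q ^ (1 / 4)` the two terms of `hbound` balance: the average acceptance probability is
  -- at most `p ^ 3 / q = 1 / p`.
  set p : ℝ := √(√q) with hp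
  have hp2 : p ^ 2 = √q := Real.sq_sqrt (Real.sqrt_nonneg _)
  have hp4 : p ^ 4 = q := by
    rw [show p ^ 4 = (p ^ 2) ^ 2 by ring, hp2, Real.sq_sqrt (by linarith)]
  have hp87 : 8 / 7 ≤ p := by
    by_contra! h
    have : p ^ 4 < (8 / 7) ^ 4 := pow_lt_pow_left₀ h (Real.sqrt_nonneg _) (by norm_num)
    rw [hp4] at this
    norm_num at this
    linarith
  have hp0 : 0 < p := by linarith
  -- State `s` is accepted when its loss is below `η / 2`; by separation at most one state is
  -- accepted.
  let T : S → Y → ℝ := fun s y => if L s y < η / 2 then 1 else 0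
  have hT0 : ∀ s y, 0 ≤ T s y := fun s y => by dsimp only [T]; split_ifs <;> norm_num
  have hT1 : ∀ s y, T s y ≤ 1 := fun s y => by dsimp only [T]; split_ifs <;> norm_num
  have hTsum : ∀ y, ∑ s, T s y ≤ 1 := by
    intro y
    by_cases h : ∃ s, L s y < η / 2
    · obtain ⟨s, hs⟩ := h
      rw [Finset.sum_eq_single_of_mem s (Finset.mem_univ _)]
      · exact hT1 s y
      · intro t _ hts
        have := hsep t s y hts
        simp only [T]
        rw [if_neg (by linarith)]
    · push Not at h
      rw [Finset.sum_eq_zero (fun s _ => by simp only [T]; rw [if_neg (by linarith [h s])])]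
      norm_num
  have hloss : ∀ s y, η / 2 * (w s y - w s y * T s y) ≤ w s y * L s y := by
    intro s y
    simp only [T]
    split_ifs with h
    · have := mul_nonneg (hw s y).le (hL s y)
      linarith
    · have := mul_le_mul_of_nonneg_left (not_lt.1 h) (hw s y).le
      linarith
  -- AM-GM with weight `p ^ 3`, a change of measure from `w s` to the reference `w s₀`.
  have hpt : ∀ s y, w s y * T s y ≤
      p ^ 3 / 2 * (w s₀ y * T s y) + 1 / (2 * p ^ 3) * (w s y ^ 2 / w s₀ y) := by
    intro s y
    have h0 := hw s₀ y
    have h3 : 0 < p ^ 3 := by positivity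
    have hsq : 0 ≤ (p ^ 3 * w s₀ y - w s y) ^ 2 / (2 * p ^ 3 * w s₀ y) := by positivity
    have hexp : (p ^ 3 * w s₀ y - w s y) ^ 2 / (2 * p ^ 3 * w s₀ y) =
        p ^ 3 / 2 * w s₀ y + 1 / (2 * p ^ 3) * (w s y ^ 2 / w s₀ y) - w s y := by
      field_simp
      ring
    have hnn : 0 ≤ 1 / (2 * p ^ 3) * (w s y ^ 2 / w s₀ y) := by positivity
    simp only [T]
    split_ifs
    · linarith
    · linarith
  have hbound : ∑ s, ∑ y, w s y * T s y ≤ p ^ 3 := by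
    calc ∑ s, ∑ y, w s y * T s y
        ≤ ∑ s, ∑ y, (p ^ 3 / 2 * (w s₀ y * T s y) + 1 / (2 * p ^ 3) * (w s y ^ 2 / w s₀ y)) :=
          Finset.sum_le_sum fun s _ => Finset.sum_le_sum fun y _ => hpt s y
      _ = p ^ 3 / 2 * ∑ y, w s₀ y * ∑ s, T s y
            + 1 / (2 * p ^ 3) * ∑ s, ∑ y, w s y ^ 2 / w s₀ y := by
          simp only [Finset.sum_add_distrib, ← Finset.mul_sum]
          rw [Finset.sum_comm]
          simp only [Finset.mul_sum]
      _ ≤ p ^ 3 / 2 * ∑ y, w s₀ y * 1 + 1 / (2 * p ^ 3) * ∑ _s : S, √q := by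
          gcongr with y _ s _
          · exact (hw s₀ y).le
          · exact hTsum y
          · exact hH s
      _ = p ^ 3 := by
          simp only [mul_one, hw1, Finset.sum_const, Finset.card_univ, nsmul_eq_mul]
          rw [← hqdef, ← hp2, ← hp4]
          field_simp
          ring
  -- Hence at least `q / 8` of the total mass is rejected, each part with loss at least `η / 2`.
  have hp3 : p ^ 3 ≤ 7 / 8 * q := by
    rw [← hp4]
    have := mul_le_mul_of_nonneg_left hp87 (by positivity : 0 ≤ p ^ 3)
    linarith [show p ^ 4 = p ^ 3 * p by ring]
  calc q * (η / 16) ≤ η / 2 * (q - p ^ 3) := by nlinarith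
    _ ≤ η / 2 * (q - ∑ s, ∑ y, w s y * T s y) := by gcongr
    _ = ∑ s, ∑ y, η / 2 * (w s y - w s y * T s y) := by
        simp only [← Finset.mul_sum, Finset.sum_sub_distrib, hw1]
        simp [hqdef]
    _ ≤ _ := Finset.sum_le_sum fun s _ => Finset.sum_le_sum fun y _ => hloss s y

/-- A block-wise lower bound on the Bayes risk for the uniform prior on `ι → S`. For two states it
is Assouad's lemma. -/
lemma sum_expected_block_loss_ge {ι S Y : Type*} [Fintype ι] [DecidableEq ι] [Fintype S]
    [Fintype Y] (hq : 2 ≤ Fintype.card S) (w : (ι → S) → Y → ℝ) (hw : ∀ τ y, 0 < w τ y)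
    (hw1 : ∀ τ, ∑ y, w τ y = 1) (s₀ : S)
    (hH : ∀ τ b s, ∑ y, w (Function.update τ b s) y ^ 2 / w (Function.update τ b s₀) y
      ≤ √(Fintype.card S))
    (L : ι → S → Y → ℝ) (hL : ∀ b s y, 0 ≤ L b s y) (η : ℝ) (hη : 0 ≤ η)
    (hsep : ∀ b s t y, s ≠ t → η ≤ L b s y + L b t y) :
    (Fintype.card (ι → S) : ℝ) * (Fintype.card ι * (η / 16)) ≤
      ∑ τ, ∑ y, w τ y * ∑ b, L b (τ b) y := by
  have hblock : ∀ b, (Fintype.card (ι → S) : ℝ) * (η / 16) ≤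
      ∑ τ, ∑ y, w τ y * L b (τ b) y := by
    intro b
    have hcard : (0 : ℝ) < Fintype.card S := by
      have : 0 < Fintype.card S := by omega
      exact_mod_cast this
    refine le_of_mul_le_mul_left ?_ hcard
    rw [card_mul_sum_eq_sum_sum_update b]
    calc (Fintype.card S : ℝ) * (Fintype.card (ι → S) * (η / 16))
        = ∑ _τ : ι → S, (Fintype.card S : ℝ) * (η / 16) := by
          rw [Finset.sum_const, Finset.card_univ, nsmul_eq_mul]
          ring
      _ ≤ _ := Finset.sum_le_sum fun τ _ => by
          simp only [Function.update_self]
          exact sum_expected_loss_ge hq (fun s => w (Function.update τ b s)) (fun s => hw _)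
            (fun s => hw1 _) s₀ (hH τ b) (L b) (hL b) η hη (hsep b)
  calc (Fintype.card (ι → S) : ℝ) * (Fintype.card ι * (η / 16))
      = ∑ _b : ι, (Fintype.card (ι → S) : ℝ) * (η / 16) := by
        rw [Finset.sum_const, Finset.card_univ, nsmul_eq_mul]
        ring
    _ ≤ ∑ b, ∑ τ, ∑ y, w τ y * L b (τ b) y := Finset.sum_le_sum fun b _ => hblock b
    _ = _ := by
        rw [Finset.sum_comm]
        refine Finset.sum_congr rfl fun τ _ => ?_
        rw [Finset.sum_comm]
        simp only [Finset.mul_sum]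

/-! ### `χ²`-affinity of logistic Bernoulli laws -/

/-- The mass function of the Bernoulli law with log-odds `x`. -/
noncomputable def logisticMass (x : ℝ) (b : Bool) : ℝ :=
  if b then Real.sigmoid x else 1 - Real.sigmoid x

lemma logisticMass_pos (x : ℝ) (b : Bool) : 0 < logisticMass x b := by
  have h0 := Real.sigmoid_pos x
  have h1 := Real.sigmoid_lt_one x
  cases b <;> simp [logisticMass] <;> linarith

lemma sum_logisticMass (x : ℝ) : ∑ b, logisticMass x b = 1 := by
  simp [logisticMass]

/-- The `χ²`-affinity of two Bernoulli laws is Gaussian in the difference of the log-odds. -/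
lemma sum_logisticMass_sq_div_le (x z : ℝ) :
    ∑ b, logisticMass x b ^ 2 / logisticMass z b ≤ Real.exp ((x - z) ^ 2 / 4) := by
  obtain ⟨t, rfl⟩ : ∃ t, x = z + 2 * t := ⟨(x - z) / 2, by ring⟩
  have hcosh : Real.cosh t ^ 2 ≤ Real.exp ((z + 2 * t - z) ^ 2 / 4) := by
    calc Real.cosh t ^ 2 ≤ Real.exp (t ^ 2 / 2) ^ 2 :=
          pow_le_pow_left₀ (Real.cosh_pos t).le (Real.cosh_le_exp_half_sq t) 2
      _ = Real.exp ((z + 2 * t - z) ^ 2 / 4) := by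
          rw [← Real.exp_nat_mul]
          congr 1
          push_cast
          ring
  refine le_trans ?_ hcosh
  simp only [Fintype.sum_bool, logisticMass, if_true, ← Real.sigmoid_neg, Bool.false_eq_true,
    if_false]
  simp only [Real.sigmoid_def, neg_neg, Real.cosh_eq, neg_add, Real.exp_add,
    show 2 * t = t + t by ring, Real.exp_neg]
  have hE := Real.exp_pos z
  have hF := Real.exp_pos t
  generalize Real.exp z = E at *
  generalize Real.exp t = F at *
  rw [← sub_nonneg]
  -- The affinity is at most `cosh t ^ 2`, where `2 t` is the difference of log-odds: in `E = exp z`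
  -- and `F = exp t` the gap is a quotient of squares.
  have key : ((F + F⁻¹) / 2) ^ 2 - ((1 + E⁻¹ * (F⁻¹ * F⁻¹))⁻¹ ^ 2 / (1 + E⁻¹)⁻¹
      + (1 + E * (F * F))⁻¹ ^ 2 / (1 + E)⁻¹)
      = (F ^ 2 - 1) ^ 2 * (1 - E * F ^ 2) ^ 2 / (4 * F ^ 2 * (1 + E * F ^ 2) ^ 2) := by
    field_simp
    ring
  rw [key]
  positivity

/-! ### From Bayes risk to minimax risk -/

section LowerBound

variable {d n : ℕ} (Ω : Finset (Fin n × Fin n)) (X : Matrix (Fin d) (Fin n) ℝ)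

/-- The mass function of `dataLaw`. -/
noncomputable def dataMass (Θ : Matrix (Fin d) (Fin d) ℝ) (y : Ω → Bool) : ℝ :=
  ∏ e : Ω, logisticMass (affinity X Θ e.1.1 e.1.2) (y e)

lemma dataMass_pos (Θ : Matrix (Fin d) (Fin d) ℝ) (y : Ω → Bool) : 0 < dataMass Ω X Θ y :=
  Finset.prod_pos fun _ _ => logisticMass_pos _ _

lemma sum_prod_bool (f : Ω → Bool → ℝ) : ∑ y : Ω → Bool, ∏ e, f e (y e) = ∏ e, ∑ b, f e b := by
  rw [Finset.prod_univ_sum, Fintype.piFinset_univ]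

lemma sum_dataMass (Θ : Matrix (Fin d) (Fin d) ℝ) : ∑ y, dataMass Ω X Θ y = 1 := by
  simp only [dataMass]
  rw [sum_prod_bool Ω fun e => logisticMass (affinity X Θ e.1.1 e.1.2)]
  simp only [sum_logisticMass, Finset.prod_const_one]

/-- Independence makes the affinity a product over `Ω`, so the exponents add up to the semi-norm. -/
lemma sum_dataMass_sq_div_le (Θ Θ' : Matrix (Fin d) (Fin d) ℝ) :
    ∑ y, dataMass Ω X Θ y ^ 2 / dataMass Ω X Θ' y ≤
      Real.exp (frobSqOn Ω (affinity X (Θ - Θ')) / 4) := by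
  simp only [dataMass, ← Finset.prod_pow, ← Finset.prod_div_distrib]
  rw [sum_prod_bool Ω fun e b => logisticMass (affinity X Θ e.1.1 e.1.2) b ^ 2 /
    logisticMass (affinity X Θ' e.1.1 e.1.2) b]
  calc _ ≤ ∏ e : Ω, Real.exp ((affinity X Θ e.1.1 e.1.2 - affinity X Θ' e.1.1 e.1.2) ^ 2 / 4) :=
        Finset.prod_le_prod
          (fun e _ => Finset.sum_nonneg fun b _ =>
            div_nonneg (sq_nonneg _) (logisticMass_pos _ _).le)
          (fun e _ => sum_logisticMass_sq_div_le _ _)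
    _ = _ := by
        have hsub : affinity X (Θ - Θ') = affinity X Θ - affinity X Θ' := by
          simp [affinity, Matrix.mul_sub, Matrix.sub_mul]
        rw [← Real.exp_sum, ← Finset.sum_div, hsub, frobSqOn, ← Finset.sum_coe_sort Ω]
        rfl

lemma frobSq_nonneg (A : Matrix (Fin d) (Fin d) ℝ) : 0 ≤ frobSq A :=
  Finset.sum_nonneg fun _ _ => Finset.sum_nonneg fun _ _ => sq_nonneg _

lemma sum_sum_sq_le_frobSq {ι : Type*} [Fintype ι] (E : ι → Finset (Fin d × Fin d))
    (hE : Pairwise fun b b' => Disjoint (E b) (E b')) (A : Matrix (Fin d) (Fin d) ℝ) :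
    ∑ b, ∑ e ∈ E b, A e.1 e.2 ^ 2 ≤ frobSq A := by
  classical
  rw [frobSq, ← Fintype.sum_prod_type' (f := fun i j => A i j ^ 2),
    ← Finset.sum_biUnion fun b _ b' _ h => hE h]
  exact Finset.sum_le_univ_sum_of_nonneg fun e => sq_nonneg _

lemma dataLaw_singleton (Θ : Matrix (Fin d) (Fin d) ℝ) (y : Ω → Bool) :
    dataLaw Ω X Θ {y} = ENNReal.ofReal (dataMass Ω X Θ y) := by
  rw [dataLaw, Measure.pi_singleton, dataMass,
    ENNReal.ofReal_prod_of_nonneg fun e _ => (logisticMass_pos _ _).le]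
  refine Finset.prod_congr rfl fun e _ => ?_
  rw [← ENNReal.ofReal_toReal (measure_ne_top _ _)]
  congr 1
  change (bernoulliMeasure true false _).real _ = _
  rw [bernoulliMeasure_real_apply _ (MeasurableSet.singleton _)]
  cases y e <;> simp [logisticMass] <;> rfl

lemma risk_eq_ofReal_sum (est : (Ω → Bool) → Matrix (Fin d) (Fin d) ℝ)
    (Θ : Matrix (Fin d) (Fin d) ℝ) :
    risk Ω X est Θ = ENNReal.ofReal (∑ y, dataMass Ω X Θ y * frobSq (est y - Θ)) := by
  rw [risk, lintegral_fintype,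
    ENNReal.ofReal_sum_of_nonneg fun y _ =>
      mul_nonneg (dataMass_pos Ω X Θ y).le (frobSq_nonneg _)]
  refine Finset.sum_congr rfl fun y _ => ?_
  rw [dataLaw_singleton, ENNReal.ofReal_mul (dataMass_pos Ω X Θ y).le, mul_comm]

/-- Lower bound on the minimax risk from a family of parameters indexed by a product `ι → S`. The
state of block `b` is read off from the entries in `E b`. -/
lemma ofReal_le_minimaxRisk {ι S : Type*} [Fintype ι] [DecidableEq ι] [Fintype S]
    (hq : 2 ≤ Fintype.card S) (s₀ : S) (k r : ℕ) (M : ℝ)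
    (Θ : (ι → S) → Matrix (Fin d) (Fin d) ℝ) (hΘ : ∀ τ, Θ τ ∈ paramSpace d k r M)
    (E : ι → Finset (Fin d × Fin d)) (hE : Pairwise fun b b' => Disjoint (E b) (E b'))
    (g : ι → S → Fin d × Fin d → ℝ) (hg : ∀ τ b, ∀ e ∈ E b, Θ τ e.1 e.2 = g b (τ b) e)
    (η : ℝ) (hη : 0 ≤ η) (hsep : ∀ b s t, s ≠ t → η ≤ ∑ e ∈ E b, (g b s e - g b t e) ^ 2)
    (hclose : ∀ τ b s, frobSqOn Ω (affinity X
      (Θ (Function.update τ b s) - Θ (Function.update τ b s₀)))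
        ≤ 2 * Real.log (Fintype.card S)) :
    ENNReal.ofReal (Fintype.card ι * (η / 32)) ≤ minimaxRisk Ω X k r M := by
  refine le_iInf fun est => ?_
  have hq0 : (0 : ℝ) < Fintype.card S := by
    have : 0 < Fintype.card S := by omega
    exact_mod_cast this
  have hbayes := sum_expected_block_loss_ge hq (fun τ => dataMass Ω X (Θ τ))
    (fun τ => dataMass_pos Ω X _) (fun τ => sum_dataMass Ω X _) s₀
    (fun τ b s => by
      refine (sum_dataMass_sq_div_le Ω X _ _).trans ?_
      rw [Real.le_sqrt (Real.exp_pos _).le hq0.le, ← Real.exp_nat_mul,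
        ← Real.le_log_iff_exp_le hq0]
      push_cast
      linarith [hclose τ b s])
    (fun b s y => ∑ e ∈ E b, (est y e.1 e.2 - g b s e) ^ 2)
    -- `(x - y) ^ 2 ≤ 2 x ^ 2 + 2 y ^ 2` halves the separation, which turns `η / 16` into `η / 32`.
    (fun b s y => Finset.sum_nonneg fun _ _ => sq_nonneg _) (η / 2) (by linarith)
    (fun b s t y hst => by
      have h := hsep b s t hst
      have h2 : ∑ e ∈ E b, (g b s e - g b t e) ^ 2 ≤ ∑ e ∈ E b,
          (2 * (est y e.1 e.2 - g b s e) ^ 2 + 2 * (est y e.1 e.2 - g b t e) ^ 2) :=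
        Finset.sum_le_sum fun e _ => by
          nlinarith [sq_nonneg ((est y e.1 e.2 - g b s e) + (est y e.1 e.2 - g b t e))]
      rw [Finset.sum_add_distrib, ← Finset.mul_sum, ← Finset.mul_sum] at h2
      linarith)
  have hloss : ∀ τ y, ∑ b, ∑ e ∈ E b, (est y e.1 e.2 - g b (τ b) e) ^ 2 ≤
      frobSq (est y - Θ τ) := by
    intro τ y
    calc ∑ b, ∑ e ∈ E b, (est y e.1 e.2 - g b (τ b) e) ^ 2
        = ∑ b, ∑ e ∈ E b, (est y - Θ τ) e.1 e.2 ^ 2 :=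
          Finset.sum_congr rfl fun b _ => Finset.sum_congr rfl fun e he => by
            rw [Matrix.sub_apply, hg τ b e he]
      _ ≤ frobSq (est y - Θ τ) := sum_sum_sq_le_frobSq E hE _
  have hex : ∃ τ, Fintype.card ι * (η / 32) ≤
      ∑ y, dataMass Ω X (Θ τ) y * frobSq (est y - Θ τ) := by
    by_contra! h
    have : Nonempty (ι → S) := ⟨fun _ => s₀⟩
    have h1 := Finset.sum_lt_sum_of_nonempty (s := (Finset.univ : Finset (ι → S)))
      Finset.univ_nonempty fun τ _ => h τ
    have h2 : ∑ τ, ∑ y, dataMass Ω X (Θ τ) y *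
        ∑ b, ∑ e ∈ E b, (est y e.1 e.2 - g b (τ b) e) ^ 2 ≤
        ∑ τ, ∑ y, dataMass Ω X (Θ τ) y * frobSq (est y - Θ τ) :=
      Finset.sum_le_sum fun τ _ => Finset.sum_le_sum fun y _ =>
        mul_le_mul_of_nonneg_left (hloss τ y) (dataMass_pos Ω X _ y).le
    rw [Finset.sum_const, Finset.card_univ, nsmul_eq_mul] at h1
    rw [show η / 2 / 16 = η / 32 by ring] at hbayes
    linarith
  obtain ⟨τ, hτ⟩ := hex
  refine le_trans ?_ (le_iSup₂ (f := fun Θ' (_ : Θ' ∈ paramSpace d k r M) => risk Ω X est Θ')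
    (Θ τ) (hΘ τ))
  rw [risk_eq_ofReal_sum]
  exact ENNReal.ofReal_le_ofReal hτ

end LowerBound

/-! ### Norms, sparsity and rank -/

section Norms

variable {d : ℕ}

lemma frobSq_add_le (A B : Matrix (Fin d) (Fin d) ℝ) :
    frobSq (A + B) ≤ 2 * frobSq A + 2 * frobSq B := by
  simp only [frobSq, Finset.mul_sum, ← Finset.sum_add_distrib, Matrix.add_apply]
  refine Finset.sum_le_sum fun i _ => Finset.sum_le_sum fun j _ => ?_
  nlinarith [sq_nonneg (A i j - B i j)]

lemma frobSq_transpose (A : Matrix (Fin d) (Fin d) ℝ) : frobSq A.transpose = frobSq A := by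
  simp only [frobSq, Matrix.transpose_apply]
  exact Finset.sum_comm

lemma frobSq_vecMulVec (u v : Fin d → ℝ) :
    frobSq (Matrix.vecMulVec u v) = (∑ i, u i ^ 2) * ∑ j, v j ^ 2 := by
  simp only [frobSq, Matrix.vecMulVec_apply, mul_pow, Finset.sum_mul_sum]

lemma normOneOne_vecMulVec (u v : Fin d → ℝ) :
    normOneOne (Matrix.vecMulVec u v) = (∑ i, |u i|) * ∑ j, |v j| := by
  simp only [normOneOne, Matrix.vecMulVec_apply, abs_mul, Finset.sum_mul_sum]

lemma frobSq_single (i j : Fin d) (a : ℝ) : frobSq (Matrix.single i j a) = a ^ 2 := by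
  simp [frobSq, Matrix.single_apply, ite_and, ite_pow]

lemma normOneOne_single (i j : Fin d) (a : ℝ) : normOneOne (Matrix.single i j a) = |a| := by
  simp [normOneOne, Matrix.single_apply, ite_and, apply_ite abs]

lemma normOneOne_add_le (A B : Matrix (Fin d) (Fin d) ℝ) :
    normOneOne (A + B) ≤ normOneOne A + normOneOne B := by
  simp only [normOneOne, ← Finset.sum_add_distrib, Matrix.add_apply]
  exact Finset.sum_le_sum fun i _ => Finset.sum_le_sum fun j _ => abs_add_le _ _

lemma normOneOne_sum_le {ι : Type*} (s : Finset ι) (A : ι → Matrix (Fin d) (Fin d) ℝ) :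
    normOneOne (∑ b ∈ s, A b) ≤ ∑ b ∈ s, normOneOne (A b) :=
  Finset.le_sum_of_subadditive normOneOne (by simp [normOneOne]) normOneOne_add_le s A

lemma normOneOne_transpose (A : Matrix (Fin d) (Fin d) ℝ) :
    normOneOne A.transpose = normOneOne A := by
  simp only [normOneOne, Matrix.transpose_apply]
  exact Finset.sum_comm

lemma normZeroZero_le_card {A : Matrix (Fin d) (Fin d) ℝ} {s : Finset (Fin d)}
    (h : ∀ i j, A i j ≠ 0 → i ∈ s) : normZeroZero A ≤ s.card := by
  rw [normZeroZero, ← Set.ncard_coe_finset]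
  refine Set.ncard_le_ncard ?_ s.finite_toSet
  rintro i ⟨j, hj⟩
  exact h i j hj

lemma normZeroZero_sub_le (A B : Matrix (Fin d) (Fin d) ℝ) :
    normZeroZero (A - B) ≤ normZeroZero A + normZeroZero B := by
  refine (Set.ncard_le_ncard ?_ (Set.toFinite _)).trans (Set.ncard_union_le _ _)
  rintro i ⟨j, hj⟩
  by_contra h
  simp only [Set.mem_union, Set.mem_ofPred_eq, not_or, not_exists, not_not] at h
  exact hj (by simp [h.1 j, h.2 j])

lemma rank_add_transpose_le (A : Matrix (Fin d) (Fin d) ℝ) :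
    (A + A.transpose).rank ≤ 2 * A.rank := by
  have hrange : LinearMap.range (A + A.transpose).mulVecLin ≤
      LinearMap.range A.mulVecLin ⊔ LinearMap.range A.transpose.mulVecLin := by
    rintro _ ⟨x, rfl⟩
    rw [Matrix.mulVecLin_add]
    exact Submodule.add_mem_sup ⟨x, rfl⟩ ⟨x, rfl⟩
  have h := (Submodule.finrank_mono hrange).trans
    (Submodule.finrank_add_le_finrank_add_finrank _ _)
  change (A + A.transpose).rank ≤ A.rank + A.transpose.rank at h
  rw [Matrix.rank_transpose] at h
  omega

end Norms

variable {d n : ℕ} {Ω : Finset (Fin n × Fin n)} {X : Matrix (Fin d) (Fin n) ℝ} {k r : ℕ} {M : ℝ}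

/-- A difference of two parameters has up to `2 * k` non-zero rows, hence the block size. Bounding
`1 + δ` by `2` removes the isometry constant from later estimates. -/
lemma BlockIsometryProperty.frobSqOn_sub_le (hX : BlockIsometryProperty Ω (2 * k) X)
    {Θ Θ' : Matrix (Fin d) (Fin d) ℝ} (hΘ : Θ ∈ paramSpace d k r M)
    (hΘ' : Θ' ∈ paramSpace d k r M) :
    frobSqOn Ω (affinity X (Θ - Θ')) ≤ 2 * Ω.card * frobSq (Θ - Θ') := by
  obtain ⟨δ, -, hδ1, hδ⟩ := hX
  obtain ⟨hs, -, hz, -⟩ := hΘ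
  obtain ⟨hs', -, hz', -⟩ := hΘ'
  have h := (hδ (Θ - Θ') (hs.sub hs') ((normZeroZero_sub_le _ _).trans (by omega))).2
  have h0 := frobSq_nonneg (Θ - Θ')
  have hN : (0 : ℝ) ≤ Ω.card := Nat.cast_nonneg _
  have : (Ω.card : ℝ) * (1 + δ) * frobSq (Θ - Θ') ≤ Ω.card * 2 * frobSq (Θ - Θ') := by
    gcongr
    linarith
  linarith

/-! ### Hub vectors with one small coordinate per block -/

/-- The standard basis vector at `φ (some (b, p))` in state `some p`, and `0` in state `none`. -/
noncomputable def stateVec {ι κ : Type*} (φ : Option (ι × κ) ↪ Fin d) (b : ι) (s : Option κ) :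
    Fin d → ℝ :=
  s.elim 0 fun p => Pi.single (φ (some (b, p))) 1

section StateVec

variable {ι κ : Type*} (φ : Option (ι × κ) ↪ Fin d)

lemma stateVec_nonneg (b : ι) (s : Option κ) (i : Fin d) : 0 ≤ stateVec φ b s i := by
  cases s with
  | none => simp [stateVec]
  | some p =>
    simp only [stateVec, Option.elim_some, Pi.single_apply]
    split_ifs <;> norm_num

lemma sum_stateVec_le (b : ι) (s : Option κ) : ∑ i, stateVec φ b s i ≤ 1 := by
  cases s <;> simp [stateVec]

lemma sum_stateVec_sq_le (b : ι) (s : Option κ) : ∑ i, stateVec φ b s i ^ 2 ≤ 1 := by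
  cases s <;> simp [stateVec, Pi.single_apply]

lemma stateVec_apply_none (b : ι) (s : Option κ) : stateVec φ b s (φ none) = 0 := by
  cases s <;> simp [stateVec]

lemma stateVec_apply_some_of_ne {b b' : ι} (h : b ≠ b') (s : Option κ) (p : κ) :
    stateVec φ b s (φ (some (b', p))) = 0 := by
  cases s <;> simp [stateVec, h.symm]

lemma stateVec_apply_some [DecidableEq κ] (b : ι) (s : Option κ) (p : κ) :
    stateVec φ b s (φ (some (b, p))) = if s = some p then 1 else 0 := by
  cases s <;> simp [stateVec, Pi.single_apply, eq_comm]

/-- Two distinct states are told apart by one of the coordinates of their block. -/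
lemma exists_stateVec_sub_sq_eq_one (b : ι) {s t : Option κ} (h : s ≠ t) :
    ∃ p, (stateVec φ b s (φ (some (b, p))) - stateVec φ b t (φ (some (b, p)))) ^ 2 = 1 := by
  classical
  simp only [stateVec_apply_some]
  cases s with
  | none =>
    cases t with
    | none => exact absurd rfl h
    | some p => exact ⟨p, by simp⟩
  | some p => exact ⟨p, by simp [h.symm]⟩

variable [Fintype ι]

/-- The vector with a `1` at the reference coordinate and entries `ε` at the coordinates chosen
by `τ`. -/
noncomputable def hubVec (ε : ℝ) (τ : ι → Option κ) : Fin d → ℝ :=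
  Pi.single (φ none) 1 + ε • ∑ b, stateVec φ b (τ b)

lemma hubVec_apply (ε : ℝ) (τ : ι → Option κ) (i : Fin d) :
    hubVec φ ε τ i = Pi.single (M := fun _ => ℝ) (φ none) 1 i
      + ε * ∑ b, stateVec φ b (τ b) i := by
  simp [hubVec]

lemma hubVec_nonneg {ε : ℝ} (hε : 0 ≤ ε) (τ : ι → Option κ) (i : Fin d) :
    0 ≤ hubVec φ ε τ i := by
  rw [hubVec_apply]
  refine add_nonneg ?_ (mul_nonneg hε (Finset.sum_nonneg fun b _ => stateVec_nonneg φ b _ i))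
  rw [Pi.single_apply]
  split_ifs <;> norm_num

lemma sum_hubVec_le {ε : ℝ} (hε : 0 ≤ ε) (τ : ι → Option κ) :
    ∑ i, hubVec φ ε τ i ≤ 1 + ε * Fintype.card ι := by
  simp only [hubVec_apply, Finset.sum_add_distrib, ← Finset.mul_sum]
  rw [Finset.sum_comm, Finset.sum_pi_single']
  simp only [Finset.mem_univ, if_true]
  gcongr
  calc ∑ b, ∑ i, stateVec φ b (τ b) i ≤ ∑ _b : ι, (1 : ℝ) :=
        Finset.sum_le_sum fun b _ => sum_stateVec_le φ b _
    _ = Fintype.card ι := by simp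

lemma hubVec_apply_none (ε : ℝ) (τ : ι → Option κ) : hubVec φ ε τ (φ none) = 1 := by
  simp [hubVec_apply, stateVec_apply_none]

lemma hubVec_apply_some (ε : ℝ) (τ : ι → Option κ) (b : ι) (p : κ) :
    hubVec φ ε τ (φ (some (b, p))) = ε * stateVec φ b (τ b) (φ (some (b, p))) := by
  rw [hubVec_apply, Fintype.sum_eq_single b fun b' hb' => stateVec_apply_some_of_ne φ hb' _ p]
  simp

lemma hubVec_update [DecidableEq ι] (ε : ℝ) (τ : ι → Option κ) (b : ι) (s : Option κ) :
    hubVec φ ε (Function.update τ b s) =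
      hubVec φ ε (Function.update τ b none) + ε • stateVec φ b s := by
  have h : ∀ s, ∑ b', stateVec φ b' (Function.update τ b s b') =
      stateVec φ b s + ∑ b' ∈ Finset.univ.erase b, stateVec φ b' (τ b') := by
    intro s
    rw [← Finset.add_sum_erase _ _ (Finset.mem_univ b), Function.update_self]
    congr 1
    refine Finset.sum_congr rfl fun b' hb' => ?_
    rw [Function.update_of_ne (Finset.ne_of_mem_erase hb')]
  have h0 : stateVec φ b none = 0 := rfl
  simp only [hubVec, h, h0, zero_add, smul_add]
  abel

/-- Each block selects at most one coordinate, so sparsity does not depend on the size of the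
groups. -/
lemma exists_card_le_hubVec_support (ε : ℝ) (τ : ι → Option κ) :
    ∃ s : Finset (Fin d), s.card ≤ Fintype.card ι + 1 ∧ ∀ i, hubVec φ ε τ i ≠ 0 → i ∈ s := by
  classical
  refine ⟨insert (φ none) (Finset.univ.biUnion fun b =>
    (τ b).elim ∅ fun p => {φ (some (b, p))}), ?_, ?_⟩
  · refine (Finset.card_insert_le _ _).trans (Nat.succ_le_succ ?_)
    refine (Finset.card_biUnion_le_card_mul _ _ 1 fun b _ => ?_).trans (by simp)
    cases τ b <;> simp
  · intro i hi
    by_contra hmem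
    simp only [Finset.mem_insert, Finset.mem_biUnion, Finset.mem_univ, true_and, not_or,
      not_exists] at hmem
    refine hi ?_
    rw [hubVec_apply, Pi.single_eq_of_ne hmem.1, Finset.sum_eq_zero, mul_zero, add_zero]
    intro b _
    have hb := hmem.2 b
    cases hτ : τ b with
    | none => rfl
    | some p =>
      rw [hτ] at hb
      simp only [Option.elim_some, Finset.mem_singleton] at hb
      simp [stateVec, Pi.single_eq_of_ne hb]

end StateVec

/-! ### The three families of parameters -/

lemma sum_sq_le_sq_sum {u : Fin d → ℝ} (hu : ∀ i, 0 ≤ u i) : ∑ i, u i ^ 2 ≤ (∑ i, u i) ^ 2 :=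
  Finset.sum_sq_le_sq_sum_of_nonneg fun i _ => hu i

/-- Lower bound from rank-one parameters `a u uᵀ`, where `u` has a fixed large coordinate and
`K` small coordinates, one in each of `K` groups of `m` coordinates. -/
lemma ofReal_le_minimaxRisk_sparse {K m : ℕ} (hK : K + 1 = k) (hm : 1 ≤ m) (hd : K * m + 1 ≤ d)
    (hr : 1 ≤ r) (hX : BlockIsometryProperty Ω (2 * k) X) {a : ℝ} (ha : 0 ≤ a) (haM : 4 * a < M)
    (hlog : 16 * Ω.card * (a ^ 2 / k ^ 2) ≤ Real.log (m + 1)) :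
    ENNReal.ofReal (K * (a ^ 2 / k ^ 2 / 32)) ≤ minimaxRisk Ω X k r M := by
  classical
  obtain ⟨φ⟩ : Nonempty (Option (Fin K × Fin m) ↪ Fin d) :=
    Function.Embedding.nonempty_of_card_le (by simpa using hd)
  have hk : (0 : ℝ) < k := by
    rw [← hK]
    positivity
  have hε : (0 : ℝ) ≤ 1 / k := by positivity
  -- The scale `1 / k` keeps the `ℓ¹` norm of `u` below `2`, so `a u uᵀ` has `ℓ¹` norm at most `4 *
  -- a`.
  set u : (Fin K → Option (Fin m)) → Fin d → ℝ := hubVec φ (1 / k) with hu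
  have hu0 : ∀ τ i, 0 ≤ u τ i := hubVec_nonneg φ hε
  have hu1 : ∀ τ, ∑ i, u τ i ≤ 2 := by
    intro τ
    refine (sum_hubVec_le φ hε τ).trans ?_
    have hKk : (K : ℝ) ≤ k := by
      rw [← hK]
      push_cast
      linarith
    have : 1 / (k : ℝ) * K ≤ 1 := by
      rw [one_div_mul_eq_div, div_le_one hk]
      exact hKk
    simp only [Fintype.card_fin]
    linarith
  have hu2 : ∀ τ, ∑ i, u τ i ^ 2 ≤ 4 := by
    intro τ
    refine (sum_sq_le_sq_sum (hu0 τ)).trans ?_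
    have := pow_le_pow_left₀ (Finset.sum_nonneg fun i _ => hu0 τ i) (hu1 τ) 2
    linarith
  have hmem : ∀ τ, Matrix.vecMulVec (a • u τ) (u τ) ∈ paramSpace d k r M := by
    intro τ
    refine ⟨?_, ?_, ?_, (Matrix.rank_vecMulVec_le _ _).trans hr⟩
    · ext i j
      simp [Matrix.vecMulVec_apply]
      ring
    · rw [normOneOne_vecMulVec]
      simp only [Pi.smul_apply, smul_eq_mul, abs_mul, abs_of_nonneg ha, abs_of_nonneg (hu0 τ _),
        ← Finset.mul_sum]
      have h0 : 0 ≤ ∑ i, u τ i := Finset.sum_nonneg fun i _ => hu0 τ i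
      have := pow_le_pow_left₀ h0 (hu1 τ) 2
      nlinarith
    · obtain ⟨s, hs, hsupp⟩ := exists_card_le_hubVec_support φ (1 / k) τ
      refine (normZeroZero_le_card fun i j hij => hsupp i fun h => hij ?_).trans
        (hs.trans (by simp [hK]))
      rw [Matrix.vecMulVec_apply, Pi.smul_apply, hu, h, smul_zero, zero_mul]
  have hmain := ofReal_le_minimaxRisk Ω X (ι := Fin K) (S := Option (Fin m))
    (by simp only [Fintype.card_option, Fintype.card_fin]; omega) none k r M
    (fun τ => Matrix.vecMulVec (a • u τ) (u τ)) hmem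
    -- Only the hub row is read: there the hub factor is `1`, and the entry is linear in the state
    -- of its block.
    (fun b => Finset.univ.image fun p => (φ none, φ (some (b, p))))
    (by
      intro b b' hbb'
      refine Finset.disjoint_left.2 fun e he he' => ?_
      simp only [Finset.mem_image, Finset.mem_univ, true_and] at he he'
      obtain ⟨p, rfl⟩ := he
      obtain ⟨p', hp'⟩ := he'
      simp only [Prod.mk.injEq, true_and, EmbeddingLike.apply_eq_iff_eq, Option.some.injEq] at hp'
      exact hbb' hp'.1.symm)
    (fun b s e => a / k * stateVec φ b s e.2)
    (by
      intro τ b e he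
      simp only [Finset.mem_image, Finset.mem_univ, true_and] at he
      obtain ⟨p, rfl⟩ := he
      simp only [Matrix.vecMulVec_apply, Pi.smul_apply, smul_eq_mul, hu, hubVec_apply_none,
        hubVec_apply_some]
      ring)
    (a ^ 2 / k ^ 2) (by positivity)
    (by
      intro b s t hst
      obtain ⟨p, hp⟩ := exists_stateVec_sub_sq_eq_one φ b hst
      refine le_trans (le_of_eq ?_) (Finset.single_le_sum (fun e _ => sq_nonneg _)
        (Finset.mem_image_of_mem (fun p => (φ none, φ (some (b, p)))) (Finset.mem_univ p)))
      rw [← mul_sub, mul_pow, hp]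
      ring)
    (by
      intro τ b s
      refine (hX.frobSqOn_sub_le (hmem _) (hmem _)).trans ?_
      set u₁ := u (Function.update τ b s) with hu₁
      set u₀ := u (Function.update τ b none) with hu₀
      have hdiff : u₁ = u₀ + (1 / k : ℝ) • stateVec φ b s := hubVec_update φ _ τ b s
      set z := stateVec φ b s with hz
      have hz1 : ∑ i, z i ^ 2 ≤ 1 := sum_stateVec_sq_le φ b s
      -- Each term has one factor of squared norm at most `a ^ 2 / k ^ 2` and one at most `4`, so
      -- the total is `2 * 4 + 2 * 4 = 16` times `a ^ 2 / k ^ 2`.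
      have hsplit : Matrix.vecMulVec (a • u₁) u₁ - Matrix.vecMulVec (a • u₀) u₀ =
          Matrix.vecMulVec ((a / k) • z) u₁ + Matrix.vecMulVec u₀ ((a / k) • z) := by
        ext i j
        simp only [Matrix.sub_apply, Matrix.add_apply, Matrix.vecMulVec_apply, Pi.smul_apply,
          smul_eq_mul, hdiff, Pi.add_apply]
        ring
      have hsm : ∑ i, ((a / k) • z) i ^ 2 ≤ a ^ 2 / k ^ 2 := by
        simp only [Pi.smul_apply, smul_eq_mul, mul_pow, ← Finset.mul_sum, div_pow]
        exact mul_le_of_le_one_right (by positivity) hz1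
      have hfrob : frobSq (Matrix.vecMulVec (a • u₁) u₁ - Matrix.vecMulVec (a • u₀) u₀) ≤
          16 * (a ^ 2 / k ^ 2) := by
        rw [hsplit]
        refine (frobSq_add_le _ _).trans ?_
        rw [frobSq_vecMulVec, frobSq_vecMulVec]
        have h1 := mul_le_mul hsm (hu2 (Function.update τ b s))
          (Finset.sum_nonneg fun i _ => sq_nonneg _) (by positivity)
        have h2 := mul_le_mul (hu2 (Function.update τ b none)) hsm
          (Finset.sum_nonneg fun i _ => sq_nonneg _) (by norm_num)
        linarith
      have := mul_le_mul_of_nonneg_left hfrob (by positivity : (0 : ℝ) ≤ 2 * Ω.card)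
      simp only [Fintype.card_option, Fintype.card_fin]
      push_cast
      linarith)
  simpa using hmain

/-- Lower bound from the parameters `a e_j e_jᵀ` and `0`. -/
lemma ofReal_le_minimaxRisk_one (hd : 1 ≤ d) (hr : 1 ≤ r)
    (hX : BlockIsometryProperty Ω (2 * 1) X) {a : ℝ} (ha : 0 ≤ a) (haM : a < M)
    (hlog : Ω.card * a ^ 2 ≤ Real.log (d + 1)) :
    ENNReal.ofReal (a ^ 2 / 32) ≤ minimaxRisk Ω X 1 r M := by
  classical
  let D : Option (Fin d) → Matrix (Fin d) (Fin d) ℝ := fun s =>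
    s.elim 0 fun j => Matrix.single j j a
  have hmem : ∀ s, D s ∈ paramSpace d 1 r M := by
    rintro (_ | j)
    · refine ⟨Matrix.isSymm_zero, ?_, ?_, ?_⟩
      · simpa [D, normOneOne] using ha.trans_lt haM
      · simp [D, normZeroZero]
      · simp [D]
    · have hsupp : ∀ i l, Matrix.single j j a i l ≠ 0 → i ∈ ({j} : Finset (Fin d)) := by
        intro i l h
        by_contra hi
        exact h (Matrix.single_apply_of_row_ne (fun h => hi (by simp [h])) _ _ _)
      refine ⟨Matrix.transpose_single _ _ _, ?_, ?_, ?_⟩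
      · simpa [D, normOneOne_single, abs_of_nonneg ha] using haM
      · exact normZeroZero_le_card hsupp
      · refine (Matrix.rank_le_card_of_support_subset _ {j} fun i hi => ?_).trans hr
        obtain ⟨l, hl⟩ := Function.ne_iff.1 (Function.mem_support.1 hi)
        exact hsupp i l hl
  have hmain := ofReal_le_minimaxRisk Ω X (ι := Unit) (S := Option (Fin d))
    (by simp only [Fintype.card_option, Fintype.card_fin]; omega) none 1 r M
    (fun τ => D (τ ())) (fun τ => hmem _) (fun _ => Finset.univ)
    (fun b b' h => absurd rfl h) (fun _ s e => D s e.1 e.2) (fun _ _ _ _ => rfl)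
    (a ^ 2) (sq_nonneg a)
    (by
      intro _ s t hst
      have key : ∃ j, (D s j j - D t j j) ^ 2 = a ^ 2 := by
        cases s with
        | none =>
          cases t with
          | none => exact absurd rfl hst
          | some j => exact ⟨j, by simp [D]⟩
        | some j =>
          refine ⟨j, ?_⟩
          cases t with
          | none => simp [D]
          | some l =>
            have hlj : l ≠ j := fun h => hst (by rw [h])
            simp [D, hlj]
      obtain ⟨j, hj⟩ := key
      exact hj.ge.trans (Finset.single_le_sum
        (f := fun e : Fin d × Fin d => (D s e.1 e.2 - D t e.1 e.2) ^ 2)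
        (fun e _ => sq_nonneg _) (Finset.mem_univ (j, j))))
    (by
      intro τ b s
      refine (hX.frobSqOn_sub_le (hmem _) (hmem _)).trans ?_
      have hD : frobSq (D s - D none) ≤ a ^ 2 := by
        cases s with
        | none => simpa [D, frobSq] using sq_nonneg a
        | some j => simp [D, frobSq_single]
      have := mul_le_mul_of_nonneg_left hD (by positivity : (0 : ℝ) ≤ 2 * Ω.card)
      simp only [Function.update_self, Fintype.card_option, Fintype.card_fin]
      push_cast
      linarith)
  simpa using hmain

/-- Lower bound from `0`-`a` matrices on a `p × h` off-diagonal block and its transpose. -/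
lemma ofReal_le_minimaxRisk_block {p h : ℕ} (hk : p + h = k) (hd : k ≤ d) (hr : 2 * p ≤ r)
    (hX : BlockIsometryProperty Ω (2 * k) X) {a : ℝ} (ha : 0 ≤ a) (haM : 2 * (p * h * a) < M)
    (hlog : 4 * (Ω.card * a ^ 2) ≤ Real.log 2) :
    ENNReal.ofReal (p * h * (a ^ 2 / 32)) ≤ minimaxRisk Ω X k r M := by
  classical
  obtain ⟨φ⟩ : Nonempty (Fin p ⊕ Fin h ↪ Fin d) :=
    Function.Embedding.nonempty_of_card_le (by simpa [hk] using hd)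
  let F : Fin p × Fin h → Bool → Matrix (Fin d) (Fin d) ℝ := fun b s =>
    Matrix.single (φ (.inl b.1)) (φ (.inr b.2)) (if s then a else 0)
  let A : (Fin p × Fin h → Bool) → Matrix (Fin d) (Fin d) ℝ := fun τ => ∑ b, F b (τ b)
  have hrow : ∀ τ i j, A τ i j ≠ 0 →
      i ∈ (Finset.univ.image fun x : Fin p => φ (.inl x)) ∧
      j ∈ (Finset.univ.image fun x : Fin h => φ (.inr x)) := by
    intro τ i j hij
    simp only [A, Matrix.sum_apply] at hij
    obtain ⟨b, -, hb⟩ := Finset.exists_ne_zero_of_sum_ne_zero hij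
    simp only [F, Matrix.single_apply, ne_eq, ite_eq_right_iff, not_forall] at hb
    obtain ⟨⟨h1, h2⟩, -⟩ := hb
    exact ⟨h1 ▸ Finset.mem_image_of_mem _ (Finset.mem_univ _),
      h2 ▸ Finset.mem_image_of_mem _ (Finset.mem_univ _)⟩
  have hentry : ∀ τ b, (A τ + (A τ).transpose) (φ (.inl b.1)) (φ (.inr b.2)) =
      if τ b then a else 0 := by
    intro τ b
    have h0 : A τ (φ (.inr b.2)) (φ (.inl b.1)) = 0 := by
      by_contra hne
      simpa using (hrow τ _ _ hne).1
    rw [Matrix.add_apply, Matrix.transpose_apply, h0, add_zero]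
    simp only [A, Matrix.sum_apply]
    rw [Fintype.sum_eq_single b]
    · simp [F]
    · intro b' hb'
      simp only [F, Matrix.single_apply, EmbeddingLike.apply_eq_iff_eq, Sum.inl.injEq,
        Sum.inr.injEq]
      rw [if_neg fun hh => hb' (Prod.ext hh.1 hh.2)]
  have hFnorm : ∀ b s, normOneOne (F b s) ≤ a := by
    intro b s
    simp only [F, normOneOne_single]
    split_ifs
    · rw [abs_of_nonneg ha]
    · simpa using ha
  have hmem : ∀ τ, A τ + (A τ).transpose ∈ paramSpace d k r M := by
    intro τ
    refine ⟨?_, ?_, ?_, ?_⟩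
    · exact Matrix.isSymm_add_transpose_self _
    · have h1 := normOneOne_add_le (A τ) (A τ).transpose
      rw [normOneOne_transpose] at h1
      have h2 : normOneOne (A τ) ≤ p * h * a := by
        refine (normOneOne_sum_le _ _).trans
          ((Finset.sum_le_sum fun b _ => hFnorm b (τ b)).trans (le_of_eq ?_))
        simp
      linarith
    · have hs : ∀ i j, (A τ + (A τ).transpose) i j ≠ 0 → i ∈ Finset.univ.map φ := by
        intro i j hij
        have : A τ i j ≠ 0 ∨ A τ j i ≠ 0 := by
          by_contra! hh
          exact hij (by simp [hh.1, hh.2])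
        rcases this with hh | hh
        · obtain ⟨x, -, hx⟩ := Finset.mem_image.1 (hrow τ _ _ hh).1
          simp [← hx]
        · obtain ⟨x, -, hx⟩ := Finset.mem_image.1 (hrow τ _ _ hh).2
          simp [← hx]
      exact (normZeroZero_le_card hs).trans (by simp [hk])
    · refine (rank_add_transpose_le _).trans (le_trans ?_ hr)
      -- `A τ` lives on `p` rows, so its symmetrization has rank at most `2 * p`.
      refine Nat.mul_le_mul_left 2 ((Matrix.rank_le_card_of_support_subset _
        (Finset.univ.image fun x : Fin p => φ (.inl x)) fun i hi => ?_).trans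
        (Finset.card_image_le.trans (by simp)))
      obtain ⟨l, hl⟩ := Function.ne_iff.1 (Function.mem_support.1 hi)
      exact (hrow τ i l hl).1
  have hmain := ofReal_le_minimaxRisk Ω X (ι := Fin p × Fin h) (S := Bool) (by simp) false k r M
    (fun τ => A τ + (A τ).transpose) hmem
    (fun b => {(φ (.inl b.1), φ (.inr b.2))})
    (by
      intro b b' hbb'
      rw [Finset.disjoint_singleton]
      intro hh
      simp only [Prod.mk.injEq, EmbeddingLike.apply_eq_iff_eq, Sum.inl.injEq, Sum.inr.injEq] at hh
      exact hbb' (Prod.ext hh.1 hh.2))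
    (fun b s _ => if s then a else 0)
    (by
      intro τ b e he
      rw [Finset.mem_singleton] at he
      subst he
      exact hentry τ b)
    (a ^ 2) (sq_nonneg a)
    (by
      intro b s t hst
      rw [Finset.sum_singleton]
      cases s <;> cases t <;> simp_all)
    (by
      intro τ b s
      refine (hX.frobSqOn_sub_le (hmem _) (hmem _)).trans ?_
      have hA : ∀ s, A (Function.update τ b s) =
          F b s + ∑ b' ∈ Finset.univ.erase b, F b' (τ b') := by
        intro s
        simp only [A]
        rw [← Finset.add_sum_erase _ _ (Finset.mem_univ b), Function.update_self]
        congr 1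
        refine Finset.sum_congr rfl fun b' hb' => ?_
        rw [Function.update_of_ne (Finset.ne_of_mem_erase hb')]
      have hF0 : F b false = 0 := Matrix.single_zero _ _
      have hdiff : A (Function.update τ b s) + (A (Function.update τ b s)).transpose -
          (A (Function.update τ b false) + (A (Function.update τ b false)).transpose) =
          F b s + (F b s).transpose := by
        rw [hA, hA false, hF0, zero_add, Matrix.transpose_add]
        abel
      have hfrob : frobSq (F b s + (F b s).transpose) ≤ 4 * a ^ 2 := by
        have hF : frobSq (F b s) ≤ a ^ 2 := by
          simp only [F, frobSq_single]
          split_ifs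
          · exact le_rfl
          · simpa using sq_nonneg a
        have := frobSq_add_le (F b s) (F b s).transpose
        rw [frobSq_transpose] at this
        linarith
      rw [hdiff]
      have := mul_le_mul_of_nonneg_left hfrob (mul_nonneg zero_le_two (Nat.cast_nonneg Ω.card) : (0 : ℝ) ≤ 2 * Ω.card)
      simp only [Fintype.card_bool]
      push_cast
      linarith)
  simpa using hmain

/-! ### Choice of amplitudes and block sizes -/

/-- The entropy of one block controls `log (de / k)` even when the block is as small as
possible. -/
lemma log_mul_exp_div_le {d k m : ℕ} (hd : 1 ≤ d) (hk : 1 ≤ k) (hm : 1 ≤ m)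
    (h : d ≤ k * (m + 1)) : Real.log (d * Real.exp 1 / k) ≤ 3 * Real.log (m + 1) := by
  have hk0 : (0 : ℝ) < k := by exact_mod_cast hk
  have hd0 : (0 : ℝ) < d := by exact_mod_cast hd
  have hm1 : (1 : ℝ) ≤ m := by exact_mod_cast hm
  have h' : (d : ℝ) / k ≤ m + 1 := by
    rw [div_le_iff₀ hk0, mul_comm]
    exact_mod_cast h
  have h1 : Real.log (d / k) ≤ Real.log (m + 1) := Real.log_le_log (by positivity) h'
  have h2 : Real.log 2 ≤ Real.log (m + 1) := Real.log_le_log (by norm_num) (by linarith)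
  have h3 := Real.log_two_gt_d9
  rw [mul_div_right_comm, Real.log_mul (by positivity) (Real.exp_pos 1).ne', Real.log_exp]
  linarith

lemma one_le_log_mul_exp_div {d k : ℕ} (hk : 1 ≤ k) (h : k ≤ d) :
    1 ≤ Real.log (d * Real.exp 1 / k) := by
  have hk0 : (0 : ℝ) < k := by exact_mod_cast hk
  rw [Real.le_log_iff_exp_le (by have : (k : ℝ) ≤ d := by exact_mod_cast h
                                 have : (0 : ℝ) < d := by linarith
                                 positivity),
    le_div_iff₀ hk0, mul_comm]
  gcongr

/-- The sparsity part of the lower bound. -/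
lemma ofReal_log_le_minimaxRisk {c β : ℝ} (hβ : 0 < β) (hβ1 : β ≤ 1 / 48) (hβc : β ≤ c / 32)
    (hk : 1 ≤ k) (hkd : k ≤ d) (hr : 1 ≤ r) (hM : 0 < M) (hN : (0 : ℝ) < Ω.card)
    (hX : BlockIsometryProperty Ω (2 * k) X)
    (hcM : c * (k : ℝ) ^ 2 * ((r : ℝ) ^ 2 + Real.log (d * Real.exp 1 / k))
      ≤ M ^ 2 * (Ω.card : ℝ)) :
    ENNReal.ofReal (β / 64 * (k / Ω.card * Real.log (d * Real.exp 1 / k)))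
      ≤ minimaxRisk Ω X k r M := by
  set N : ℝ := (Ω.card : ℝ) with hNdef
  set l := Real.log (d * Real.exp 1 / k) with hl
  have hl1 : 1 ≤ l := one_le_log_mul_exp_div hk hkd
  have hk1 : (1 : ℝ) ≤ k := by exact_mod_cast hk
  have hr1 : (1 : ℝ) ≤ r := by exact_mod_cast hr
  have hc : 0 < c := by linarith
  -- `β ≤ c / 32` gives `16 * a ^ 2 * N ≤ c * k ^ 2 * l / 2`, below the assumed bound on `M ^ 2 *
  -- N`.
  have haM : ∀ a : ℝ, a ^ 2 = β * k ^ 2 * l / N → 4 * a < M := by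
    intro a ha2
    refine lt_of_pow_lt_pow_left₀ 2 hM.le ?_
    rw [mul_pow, ha2, ← mul_lt_mul_iff_left₀ hN]
    refine lt_of_lt_of_le ?_ hcM
    have h1 : β * (k ^ 2 * l) ≤ c / 32 * (k ^ 2 * l) := by gcongr
    have h2 : 0 < c * (k : ℝ) ^ 2 * (r : ℝ) ^ 2 := by positivity
    have h3 : 0 < c * (k : ℝ) ^ 2 * l := by positivity
    rw [mul_assoc, div_mul_cancel₀ _ hN.ne']
    linarith
  have hsq : (√(β * k ^ 2 * l / N)) ^ 2 = β * k ^ 2 * l / N := Real.sq_sqrt (by positivity)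
  have ha4 := haM _ hsq
  obtain rfl | hk2 := hk.eq_or_lt
  · refine le_trans (ENNReal.ofReal_le_ofReal ?_)
      (ofReal_le_minimaxRisk_one hkd hr hX (Real.sqrt_nonneg (β * (1 : ℕ) ^ 2 * l / N))
        (by linarith [Real.sqrt_nonneg (β * (1 : ℕ) ^ 2 * l / N)]) ?_)
    · rw [hsq]
      push_cast
      have : 0 ≤ β * l / N := by positivity
      calc β / 64 * (1 / N * l) = β * l / N / 64 := by ring
        _ ≤ β * l / N / 32 := by linarith
        _ = _ := by ring
    · rw [hsq, ← hNdef]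
      have hlog := log_mul_exp_div_le (m := d) hkd hk hkd (by omega)
      have h1 : β * l ≤ 1 / 48 * l := by gcongr
      push_cast
      rw [← hl] at hlog
      rw [mul_div_cancel₀ _ hN.ne']
      linarith
  · obtain ⟨K, rfl⟩ : ∃ K, k = K + 1 := ⟨k - 1, by omega⟩
    have hK : 1 ≤ K := by omega
    -- One coordinate is kept for the hub; the others are shared among `K = k - 1` groups.
    set m := (d - 1) / K with hm
    have hm1 : 1 ≤ m := (Nat.one_le_div_iff (by omega)).2 (by omega)
    have hKm : K * m + 1 ≤ d := by
      have := Nat.mul_div_le (d - 1) K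
      rw [← hm] at this
      omega
    have hdm : d ≤ (K + 1) * (m + 1) := by
      have := Nat.lt_mul_div_succ (d - 1) (by omega : 0 < K)
      rw [← hm] at this
      have h2 : (K + 1) * (m + 1) = K * (m + 1) + (m + 1) := by ring
      omega
    have hlog := log_mul_exp_div_le (by omega) hk hm1 hdm
    rw [← hl] at hlog
    have hdiv : β * ((K + 1 : ℕ) : ℝ) ^ 2 * l / N / ((K + 1 : ℕ) : ℝ) ^ 2 = β * l / N := by
      field_simp
    refine le_trans (ENNReal.ofReal_le_ofReal ?_)
      (ofReal_le_minimaxRisk_sparse rfl hm1 hKm hr hX (Real.sqrt_nonneg _) ha4 ?_)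
    · rw [hsq, hdiv]
      have hK1 : (1 : ℝ) ≤ K := by exact_mod_cast hK
      have h0 : 0 ≤ β * l / N := by positivity
      push_cast
      calc β / 64 * ((K + 1) / N * l) = (K + 1) * (β * l / N) / 64 := by ring
        _ ≤ (2 * K) * (β * l / N) / 64 := by gcongr; linarith
        _ = _ := by ring
    · rw [hsq, hdiv, ← hNdef]
      -- `16 / 48 = 1 / 3` matches the factor `3` in `log_mul_exp_div_le`.
      have h1 : β * l ≤ 1 / 48 * l := by gcongr
      calc 16 * N * (β * l / N) = 16 * (β * l) := by field_simp
        _ ≤ _ := by linarith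

/-- The rank part of the lower bound, for rank at least two. -/
lemma ofReal_rank_le_minimaxRisk {c β : ℝ} (hβ : 0 < β) (hβ1 : β ≤ 1 / 48) (hβc : β ≤ c / 32)
    (hkd : k ≤ d) (hr : 2 ≤ r) (hrk : r ≤ k) (hM : 0 < M) (hN : (0 : ℝ) < Ω.card)
    (hX : BlockIsometryProperty Ω (2 * k) X)
    (hcM : c * (k : ℝ) ^ 2 * ((r : ℝ) ^ 2 + Real.log (d * Real.exp 1 / k))
      ≤ M ^ 2 * (Ω.card : ℝ)) :
    ENNReal.ofReal (β / 192 * (k * r / Ω.card)) ≤ minimaxRisk Ω X k r M := by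
  set N : ℝ := (Ω.card : ℝ) with hNdef
  have hl1 := one_le_log_mul_exp_div (by omega) hkd
  set l := Real.log (d * Real.exp 1 / k) with hl
  have hr2 : (2 : ℝ) ≤ r := by exact_mod_cast hr
  have hk2 : (2 : ℝ) ≤ k := by exact_mod_cast hr.trans hrk
  have hc : 0 < c := by linarith
  -- Rounding costs little: `r ≤ 3 * p` because `r ≥ 2`, and `k ≤ 2 * h`; thus `192 = 32 * 6`.
  obtain ⟨p, hp⟩ : ∃ p, p = r / 2 := ⟨_, rfl⟩
  obtain ⟨h, hh⟩ : ∃ h, h = k - p := ⟨_, rfl⟩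
  have hp2 : 2 * (p : ℝ) ≤ r := by exact_mod_cast (by omega : 2 * p ≤ r)
  have hp3 : (r : ℝ) ≤ 3 * p := by exact_mod_cast (by omega : r ≤ 3 * p)
  have hh2 : (k : ℝ) ≤ 2 * h := by exact_mod_cast (by omega : k ≤ 2 * h)
  have hhk : (h : ℝ) ≤ k := by exact_mod_cast (by omega : h ≤ k)
  have hsq : (√(β / N)) ^ 2 = β / N := Real.sq_sqrt (by positivity)
  refine le_trans (ENNReal.ofReal_le_ofReal ?_)
    (ofReal_le_minimaxRisk_block (p := p) (h := h) (by omega) hkd (by omega) hX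
      (Real.sqrt_nonneg (β / N)) ?_ ?_)
  · rw [hsq]
    have h0 : 0 ≤ β / N := by positivity
    have h1 : (r : ℝ) * k ≤ 3 * p * (2 * h) := by gcongr
    calc β / 192 * (k * r / N) = r * k * (β / N) / 192 := by ring
      _ ≤ 3 * p * (2 * h) * (β / N) / 192 := by gcongr
      _ = _ := by ring
  · refine lt_of_pow_lt_pow_left₀ 2 hM.le ?_
    have h1 : 2 * ((p : ℝ) * h * √(β / N)) ≤ r * k * √(β / N) := by
      calc 2 * ((p : ℝ) * h * √(β / N)) = 2 * p * h * √(β / N) := by ring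
        _ ≤ r * k * √(β / N) := by gcongr
    refine (pow_le_pow_left₀ (by positivity) h1 2).trans_lt ?_
    rw [mul_pow, hsq, ← mul_lt_mul_iff_left₀ hN]
    refine lt_of_lt_of_le ?_ hcM
    have h2 : β * ((r : ℝ) * k) ^ 2 ≤ c / 32 * ((r : ℝ) * k) ^ 2 := by gcongr
    have h3 : 0 < c * (k : ℝ) ^ 2 * l := by positivity
    have h4 : 0 < c * (k : ℝ) ^ 2 * (r : ℝ) ^ 2 := by positivity
    rw [mul_assoc, div_mul_cancel₀ _ hN.ne']
    nlinarith
  · rw [hsq, ← hNdef, mul_div_cancel₀ _ hN.ne']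
    linarith [Real.log_two_gt_d9]

end MatrixLogistic

theorem mainTheorem6 :
    ∀ c : ℝ, 0 < c → ∃ C₂ : ℝ, 0 < C₂ ∧
      ∀ (d n k r : ℕ) (M : ℝ) (Ω : Finset (Fin n × Fin n)) (X : Matrix (Fin d) (Fin n) ℝ),
        1 ≤ k → k ≤ d → 1 ≤ r → r ≤ k → 0 < M → Ω ⊆ MatrixLogistic.couples n →
        MatrixLogistic.BlockIsometryProperty Ω (2 * k) X →
        c * (k : ℝ) ^ 2 * ((r : ℝ) ^ 2 + Real.log (d * Real.exp 1 / k))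
          ≤ M ^ 2 * (Ω.card : ℝ) →
        ENNReal.ofReal
            (C₂ / (1 + MatrixLogistic.blockIsometryConst Ω (2 * k) X) *
              ((k : ℝ) * r / (Ω.card : ℝ)
                + (k : ℝ) / (Ω.card : ℝ) * Real.log (d * Real.exp 1 / k)))
          ≤ MatrixLogistic.minimaxRisk Ω X k r M := by
  intro c hc
  set β : ℝ := min (1 / 48) (c / 32) with hβdef
  have hβ : 0 < β := lt_min (by norm_num) (by linarith)
  have hβ1 : β ≤ 1 / 48 := min_le_left _ _
  have hβc : β ≤ c / 32 := min_le_right _ _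
  -- Any denominator from `256` on would do: it makes the sum of the two terms at most the larger of
  -- the two lower bounds.
  refine ⟨β / 400, by positivity, ?_⟩
  intro d n k r M Ω X hk hkd hr hrk hM _ hX hcM
  have hl1 := MatrixLogistic.one_le_log_mul_exp_div hk hkd
  have hk1 : (1 : ℝ) ≤ k := by exact_mod_cast hk
  have hN : (0 : ℝ) < Ω.card := by
    have h1 : 0 < M ^ 2 * (Ω.card : ℝ) := lt_of_lt_of_le (by positivity) hcM
    exact pos_of_mul_pos_right h1 (sq_nonneg M)
  have hΔ : 0 ≤ MatrixLogistic.blockIsometryConst Ω (2 * k) X :=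
    Real.sInf_nonneg fun δ hδ => hδ.1.le
  have hlog := MatrixLogistic.ofReal_log_le_minimaxRisk hβ hβ1 hβc hk hkd hr hM hN hX hcM
  set l := Real.log (d * Real.exp 1 / k) with hl
  set N : ℝ := (Ω.card : ℝ) with hNdef
  have hx : 0 ≤ (k : ℝ) / N * l := by positivity
  have hy : 0 ≤ (k : ℝ) * r / N := by positivity
  -- Since the isometry constant is nonnegative, its factor only weakens the bound.
  have hC : β / 400 / (1 + MatrixLogistic.blockIsometryConst Ω (2 * k) X) *
      ((k : ℝ) * r / N + k / N * l) ≤ β / 400 * ((k : ℝ) * r / N + k / N * l) := by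
    exact mul_le_mul_of_nonneg_right (div_le_self (by positivity) (by linarith)) (by positivity)
  have hβx := mul_nonneg hβ.le hx
  have hβy := mul_nonneg hβ.le hy
  -- For `r = 1` the rank family is empty of bits, but `l ≥ 1` lets the sparsity term absorb `k /
  -- N`.
  obtain rfl | hr2 := hr.eq_or_lt
  · refine le_trans (ENNReal.ofReal_le_ofReal (hC.trans ?_)) hlog
    have h1 : (k : ℝ) * (1 : ℕ) / N ≤ k / N * l := by
      rw [Nat.cast_one, mul_one]
      exact le_mul_of_one_le_right (by positivity) hl1
    have h2 := mul_le_mul_of_nonneg_left h1 hβ.le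
    linarith
  · have hrank := MatrixLogistic.ofReal_rank_le_minimaxRisk hβ hβ1 hβc hkd hr2 hrk hM hN hX hcM
    rw [← hNdef] at hrank
    rcases le_total (β / 192 * (k * r / N)) (β / 64 * (k / N * l)) with h | h
    · refine le_trans (ENNReal.ofReal_le_ofReal (hC.trans ?_)) hlog
      linarith
    · refine le_trans (ENNReal.ofReal_le_ofReal (hC.trans ?_)) hrank
      linarith
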